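/- Fix a set of propositional variables. Tense formulae in negation normal form are generated by $$A ::= p \mid \overline p \mid \top \mid \bot \mid (A\wedge A)\mid (A\vee A)\mid \square A\mid \lozenge A\mid \blacksquare A\mid \blacklozenge A ,$$ where $p$ ranges over the variables. The negation $\overline A$ is defined by dualising ($p/\overline p$, $\top/\bot$, $\wedge/\vee$, $\square/\lozenge$, $\blacksquare/\blacklozenge$), $A\to B$ abbreviates $\overline A\vee B$, and $var(A)$ is the set of variables $p$ such that $p$ or $\overline p$ occurs in $A$. A modal formula is a tense formula without $\blacksquare$ and $\blacklozenge$. The minimal tense logic $\mathsf{Kt}$ is the set of tense formulae derivable in the Hilbert system whose axioms are all instances of classical propositional tautologies and all formulae $$\overline A\vee\square\blacklozenge A,\quad \overline A\vee\blacksquare\lozenge A,\quad \lozenge(A\wedge\overline B)\vee\lozenge\overline A\vee\square B,\quad \blacklozenge(A\wedge\overline B)\vee\blacklozenge\overline A\vee\blacksquare B ,$$ and whose rules are modus ponens and necessitation for $\square$ and for $\blacksquare$. A path axiom is a scheme $\langle ?\rangle_1\cdots\langle ?\rangle_n A\to\langle ?\rangle A$ with $n\ge 0$ and each of $\langle ?\rangle_1,\dots,\langle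 ?\rangle_n,\langle ?\rangle$ in $\{\lozenge,\blacklozenge\}$. For a set $\mathsf\Pi$ of path axioms, $\mathsf{Kt\Pi}$ is obtained by adding to $\mathsf{Kt}$ all instances of the path axioms in $\mathsf\Pi$ as further axioms. The modal logic $\mathsf K$ is the set of modal formulae derivable in the Hilbert system, over modal formulae only, with the instances of tautologies, the axioms $\lozenge(A\wedge\overline B)\vee\lozenge\overline A\vee\square B$, modus ponens and necessitation for $\square$. The logics of the modal cube are the extensions of $\mathsf K$ by all modal instances of the schemes in a subset of $$\mathsf D:\ \square A\to\lozenge A,\quad \mathsf T:\ \square A\to A,\quad \mathsf B:\ A\to\square\lozenge A,\quad \mathsf 4:\ \square A\to\square\square A,\quad \mathsf 5:\ \lozenge A\to\square\lozenge A .$$ A logic $L$ (a set of formulae of a given language) has the Craig interpolation property if whenever $A$, $B$ are formulae of its language with $A\to B\in L$, there is a formula $C$ of its language with $var(C)\subseteq var(A)\cap var(B)$, $A\to C\in L$ and $C\to B\in L$. Then: 1. For every set $\mathsf\Pi$ of path axioms, $\mathsf{Kt\Pi}$ has the Craig interpolation property (in particular $\mathsf{Kt}$, for $\mathsf\Pi=\emptyset$).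 2. For every set $\mathsf\Pi$ of path axioms, the set of modal formulae in $\mathsf{Kt\Pi}$, as a logic in the language of modal formulae, has the Craig interpolation property. 3. $\mathsf K$ and all other logics of the modal cube, as logics in the language of modal formulae, have the Craig interpolation property. -/

import Mathlib

namespace TenseLogic

/-- The two temporal directions. -/
inductive Dir where
  | future
  | past

/-- The opposite direction. -/
def Dir.conv : Dir → Dir
  | .future => .past
  | .past => .future

/-- Tense formulae in negation normal form over the propositional variables `V`.
`box .future`, `dia .future` are the white modalities, `box .past`, `dia .past` the black ones. -/
inductive Formula (V : Type*) where
  | pos (p : V)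
  | neg (p : V)
  | top
  | bot
  | and (A B : Formula V)
  | or (A B : Formula V)
  | box (d : Dir) (A : Formula V)
  | dia (d : Dir) (A : Formula V)

namespace Formula

variable {V : Type*}

/-- The negation of a formula, by dualising. -/
def dual : Formula V → Formula V
  | pos p => neg p
  | neg p => pos p
  | top => bot
  | bot => top
  | and A B => or A.dual B.dual
  | or A B => and A.dual B.dual
  | box d A => dia d A.dual
  | dia d A => box d A.dual

/-- The implication `A → B`, defined as `¬A ∨ B`. -/
def imp (A B : Formula V) : Formula V := or A.dual B

/-- The propositional variables `p` such that `p` or its negation occurs in a formula. -/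
def vars : Formula V → Set V
  | pos p => {p}
  | neg p => {p}
  | top => ∅
  | bot => ∅
  | and A B => A.vars ∪ B.vars
  | or A B => A.vars ∪ B.vars
  | box _ A => A.vars
  | dia _ A => A.vars

/-- The formula contains no black modality, i.e. it is an ordinary modal formula. -/
def IsModal : Formula V → Prop
  | pos _ => True
  | neg _ => True
  | top => True
  | bot => True
  | and A B => A.IsModal ∧ B.IsModal
  | or A B => A.IsModal ∧ B.IsModal
  | box d A => d = .future ∧ A.IsModal
  | dia d A => d = .future ∧ A.IsModal

/-- A Boolean valuation of all formulae: it is arbitrary on variables and on formulae `box d A`,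
and it respects the propositional connectives, including the (defined) negation. -/
structure IsValuation (v : Formula V → Prop) : Prop where
  top : v top
  and : ∀ A B, v (and A B) ↔ v A ∧ v B
  or : ∀ A B, v (or A B) ↔ v A ∨ v B
  dual : ∀ A, v A.dual ↔ ¬ v A

/-- (Substitution instances of) classical propositional tautologies. -/
def IsTautology (A : Formula V) : Prop := ∀ v : Formula V → Prop, IsValuation v → v A

/-- `⟨d₁⟩ ⋯ ⟨dₙ⟩ A`. -/
def diaList (l : List Dir) (A : Formula V) : Formula V := l.foldr dia A

end Formula

/-- A path axiom `⟨d₁⟩ ⋯ ⟨dₙ⟩ p → ⟨d⟩ p`, with `n ≥ 0`. -/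
structure PathAxiom where
  path : List Dir
  concl : Dir

/-- The instance of a path axiom at the formula `A`. -/
def PathAxiom.inst {V : Type*} (F : PathAxiom) (A : Formula V) : Formula V :=
  (Formula.diaList F.path A).imp (.dia F.concl A)

/-- Theoremhood in the Hilbert system for the minimal tense logic `Kt` extended with all instances
of the path axioms in `P`. -/
inductive KtProvable {V : Type*} (P : Set PathAxiom) : Formula V → Prop where
  | taut {A : Formula V} : A.IsTautology → KtProvable P A
  | conv (d : Dir) (A : Formula V) : KtProvable P (.or A.dual (.box d (.dia d.conv A)))
  | distr (d : Dir) (A B : Formula V) :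
      KtProvable P (.or (.dia d (.and A B.dual)) (.or (.dia d A.dual) (.box d B)))
  | path {F : PathAxiom} (hF : F ∈ P) (A : Formula V) : KtProvable P (F.inst A)
  | mp {A B : Formula V} : KtProvable P A → KtProvable P (A.imp B) → KtProvable P B
  | nec (d : Dir) {A : Formula V} : KtProvable P A → KtProvable P (.box d A)

/-- The tense logic `KtΠ`, as its set of theorems. -/
def Kt (V : Type*) (P : Set PathAxiom) : Set (Formula V) := {A | KtProvable P A}

/-- The ordinary modal formulae (those without black modalities). -/
def modalFormulas (V : Type*) : Set (Formula V) := {A | A.IsModal}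

/-- The names of the axioms that generate the modal cube. -/
inductive CubeAxiom where
  | D
  | T
  | B
  | four
  | five

/-- The instance of one of these axioms at the formula `A`. -/
def CubeAxiom.inst {V : Type*} (A : Formula V) : CubeAxiom → Formula V
  | D => (Formula.box .future A).imp (.dia .future A)
  | T => (Formula.box .future A).imp A
  | B => A.imp (.box .future (.dia .future A))
  | four => (Formula.box .future A).imp (.box .future (.box .future A))
  | five => (Formula.dia .future A).imp (.box .future (.dia .future A))

/-- Theoremhood in the Hilbert system, in the language without black modalities, for the minimal
normal modal logic `K` extended with all instances of the axioms in `S`. -/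
inductive CubeProvable {V : Type*} (S : Set CubeAxiom) : Formula V → Prop where
  | taut {A : Formula V} : A.IsModal → A.IsTautology → CubeProvable S A
  | distr {A B : Formula V} : A.IsModal → B.IsModal →
      CubeProvable S (.or (.dia .future (.and A B.dual))
        (.or (.dia .future A.dual) (.box .future B)))
  | cube {a : CubeAxiom} (ha : a ∈ S) {A : Formula V} : A.IsModal → CubeProvable S (a.inst A)
  | mp {A B : Formula V} : CubeProvable S A → CubeProvable S (A.imp B) → CubeProvable S B
  | nec {A : Formula V} : CubeProvable S A → CubeProvable S (.box .future A)

/-- The logic of the modal cube generated by `S`, as its set of theorems; `S = ∅` gives `K`. -/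
def cubeLogic (V : Type*) (S : Set CubeAxiom) : Set (Formula V) := {A | CubeProvable S A}

/-- The Craig interpolation property of a logic `L` formulated in the language `F`. -/
def CraigInterpolation {V : Type*} (F L : Set (Formula V)) : Prop :=
  ∀ A ∈ F, ∀ B ∈ F, A.imp B ∈ L →
    ∃ C ∈ F, C.vars ⊆ A.vars ∩ B.vars ∧ A.imp C ∈ L ∧ C.imp B ∈ L

end TenseLogic

namespace TenseLogic

open Filter

universe u

variable {V : Type u}

namespace Formula

/-! The proof is semantic and amalgamates canonical models. Suppose `A → B` is a theorem without an
interpolant. Compactness (`exists_point`) then yields a canonical point `v` satisfying `A` and a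
canonical point `w` satisfying the negation of `B`, such that `v` and `w` agree on all formulae in
the language `E` over the shared variables.

Take as worlds all pairs of points that agree in this way, with componentwise accessibility.
Agreement is a bisimulation for the directions in `E` (`IsNormal.zigzag`), so both projections to
the canonical model are bounded morphisms for these directions. Reading the variables of `A` from
the first coordinate and the others from the second makes `A` true and `B` false at `(v, w)`
(`IsNormal.sat_iff`).

This contradicts soundness once the frame of pairs validates the logic. Converse, path, `T`, `B`,
`4` and `5` correspond to Horn conditions, which hold componentwise because they hold in the
canonical frame; seriality for `D` comes from the zigzag property instead. -/

@[simp] theorem dual_dual (A : Formula V) : A.dual.dual = A := by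
  induction A <;> simp_all [dual]

@[simp] theorem vars_dual (A : Formula V) : A.dual.vars = A.vars := by
  induction A <;> simp_all [dual, vars]

/-- All modalities of the formula have their direction in `D`. -/
def InLang (D : Set Dir) : Formula V → Prop
  | pos _ => True
  | neg _ => True
  | top => True
  | bot => True
  | and A B => A.InLang D ∧ B.InLang D
  | or A B => A.InLang D ∧ B.InLang D
  | box d A => d ∈ D ∧ A.InLang D
  | dia d A => d ∈ D ∧ A.InLang D

@[simp] theorem inLang_dual {D : Set Dir} {A : Formula V} : A.dual.InLang D ↔ A.InLang D := by
  induction A <;> simp_all [dual, InLang]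

@[simp] theorem inLang_imp {D : Set Dir} {A B : Formula V} :
    (A.imp B).InLang D ↔ A.InLang D ∧ B.InLang D := by
  simp [imp, InLang]

theorem InLang.mono {D E : Set Dir} (h : E ⊆ D) {A : Formula V} (hA : A.InLang E) :
    A.InLang D := by
  induction A with
  | pos | neg | top | bot => trivial
  | and A B ihA ihB => exact ⟨ihA hA.1, ihB hA.2⟩
  | or A B ihA ihB => exact ⟨ihA hA.1, ihB hA.2⟩
  | box d A ih => exact ⟨h hA.1, ih hA.2⟩
  | dia d A ih => exact ⟨h hA.1, ih hA.2⟩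

theorem inLang_univ (A : Formula V) : A.InLang Set.univ := by
  induction A <;> simp_all [InLang]

theorem isModal_iff_inLang {A : Formula V} : A.IsModal ↔ A.InLang {Dir.future} := by
  induction A <;> simp_all [IsModal, InLang]

/-- The conjunction of a list of formulae. -/
def conj (l : List (Formula V)) : Formula V := l.foldr and top

theorem conj_mem {S : Set (Formula V)} (top_mem : top ∈ S)
    (and_mem : ∀ A ∈ S, ∀ B ∈ S, A.and B ∈ S) {l : List (Formula V)} (h : ∀ A ∈ l, A ∈ S) :
    conj l ∈ S := by
  induction l with
  | nil => exact top_mem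
  | cons A l ih =>
    exact and_mem _ (h _ (by simp)) _ (ih fun B hB => h B (by simp [hB]))

/-! ### Boolean valuations -/

namespace IsValuation

variable {v : Formula V → Prop}

theorem bot (hv : IsValuation v) : ¬ v bot := fun h => (hv.dual Formula.top).1 h hv.top

theorem imp (hv : IsValuation v) {A B : Formula V} : v (A.imp B) ↔ (v A → v B) := by
  rw [Formula.imp, hv.or, hv.dual]
  tauto

theorem dia (hv : IsValuation v) {d : Dir} {A : Formula V} :
    v (dia d A) ↔ ¬ v (box d A.dual) := by
  rw [← hv.dual, Formula.dual, dual_dual]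

theorem conj (hv : IsValuation v) {l : List (Formula V)} : v (conj l) ↔ ∀ A ∈ l, v A := by
  induction l with
  | nil => simpa [Formula.conj] using hv.top
  | cons A l ih =>
    rw [List.forall_mem_cons, ← ih]
    exact hv.and A _

end IsValuation

end Formula

open Formula

/-- The compactness theorem of propositional logic. -/
theorem exists_valuation_of_finite {S : Set (Formula V)}
    (h : ∀ l : List (Formula V), (∀ A ∈ l, A ∈ S) → ∃ v, IsValuation v ∧ ∀ A ∈ l, v A) :
    ∃ v, IsValuation v ∧ ∀ A ∈ S, v A := by
  have h' : ∀ s : Finset S, ∃ v, IsValuation v ∧ ∀ A ∈ s, v A.1 := by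
    intro s
    obtain ⟨v, hv, hs⟩ := h (s.toList.map Subtype.val) (by simp +contextual)
    refine ⟨v, hv, fun A hA => hs _ ?_⟩
    simpa using hA
  choose v hv hvS using h'
  -- An ultraproduct of the valuations for finite subsets: ultrafilter limits commute with the
  -- connectives, and each member of `S` holds on the cone of finite sets containing it.
  let U : Ultrafilter (Finset S) := Ultrafilter.of atTop
  refine ⟨fun A => ∀ᶠ s in U, v s A, ⟨?_, ?_, ?_, ?_⟩, ?_⟩
  · exact .of_forall fun s => (hv s).top
  · intro A B
    simp only [(hv _).and, eventually_and]
  · intro A B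
    simp only [(hv _).or, Ultrafilter.eventually_or]
  · intro A
    simp only [(hv _).dual, Ultrafilter.eventually_not]
  · intro A hA
    have : ∀ᶠ s in atTop, v s A := by
      filter_upwards [eventually_ge_atTop ({⟨A, hA⟩} : Finset S)] with s hs
      exact hvS s ⟨A, hA⟩ (hs (by simp))
    exact Ultrafilter.of_le atTop this

/-! ### Normal logics and their canonical models -/

/-- `L` is a normal logic in the language with the modalities in `D`. -/
structure IsNormal (D : Set Dir) (L : Set (Formula V)) : Prop where
  inLang : ∀ {A}, A ∈ L → A.InLang D
  taut : ∀ {A}, A.InLang D → A.IsTautology → A ∈ L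
  mp : ∀ {A B}, A ∈ L → A.imp B ∈ L → B ∈ L
  distr : ∀ {d}, d ∈ D → ∀ {A B : Formula V}, A.InLang D → B.InLang D →
    .or (.dia d (.and A B.dual)) (.or (.dia d A.dual) (.box d B)) ∈ L
  nec : ∀ {d}, d ∈ D → ∀ {A}, A ∈ L → .box d A ∈ L

/-- A point of the canonical model: a valuation that makes all theorems true. -/
structure IsPoint (L : Set (Formula V)) (v : Formula V → Prop) : Prop extends IsValuation v where
  thm : ∀ {A}, A ∈ L → v A

/-- The accessibility relations of the canonical model. -/
def CanRel (D : Set Dir) (d : Dir) (v w : Formula V → Prop) : Prop :=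
  ∀ A : Formula V, A.InLang D → v (.box d A) → w A

theorem CanRel.dia {D : Set Dir} {d : Dir} {v w : Formula V → Prop} (h : CanRel D d v w)
    (hv : IsValuation v) (hw : IsValuation w) {A : Formula V} (hA : A.InLang D) (hwA : w A) :
    v (.dia d A) := by
  rw [hv.dia]
  exact fun hb => (hw.dual A).1 (h _ (inLang_dual.2 hA) hb) hwA

namespace IsNormal

variable {D : Set Dir} {L : Set (Formula V)}

theorem imp_mem (hL : IsNormal D L) {A B : Formula V} (hA : A ∈ L) (hB : B.InLang D)
    (h : ∀ v, IsValuation v → v A → v B) : B ∈ L :=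
  hL.mp hA (hL.taut (inLang_imp.2 ⟨hL.inLang hA, hB⟩) fun v hv => hv.imp.2 (h v hv))

theorem and_mem (hL : IsNormal D L) {A B : Formula V} (hA : A ∈ L) (hB : B ∈ L) :
    A.and B ∈ L := by
  have hA' := hL.inLang hA
  have hB' := hL.inLang hB
  refine hL.mp hB (hL.imp_mem hA (inLang_imp.2 ⟨hB', hA', hB'⟩) fun v hv h => ?_)
  rw [hv.imp, hv.and]
  exact fun h' => ⟨h, h'⟩

/-- A pair of jointly consistent theories is true at some point. -/
theorem exists_point (hL : IsNormal D L) {S T : Set (Formula V)}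
    (hS : ∀ A ∈ S, A.InLang D) (hT : ∀ A ∈ T, A.InLang D)
    (hSt : .top ∈ S) (hTt : .top ∈ T)
    (hSa : ∀ A ∈ S, ∀ B ∈ S, A.and B ∈ S) (hTa : ∀ A ∈ T, ∀ B ∈ T, A.and B ∈ T)
    (h : ∀ A ∈ S, ∀ B ∈ T, A.imp B.dual ∉ L) :
    ∃ v, IsPoint L v ∧ (∀ A ∈ S, v A) ∧ ∀ A ∈ T, v A := by
  classical
  -- `L`, `S` and `T` are each closed under conjunction, so an unsatisfiable finite list reduces to
  -- one formula from each, and the theorem taken from `L` then entails the forbidden implication.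
  obtain ⟨v, hv, hvS⟩ : ∃ v, IsValuation v ∧ ∀ A ∈ L ∪ S ∪ T, v A := by
    refine exists_valuation_of_finite fun l hl => ?_
    by_contra! hno
    have h1 : conj (l.filter (· ∈ L)) ∈ L :=
      conj_mem (hL.taut trivial fun v hv => hv.top) (fun A hA B hB => hL.and_mem hA hB)
        (by simp)
    have h2 : conj (l.filter (· ∈ S)) ∈ S := conj_mem hSt hSa (by simp)
    have h3 : conj (l.filter (· ∈ T)) ∈ T := conj_mem hTt hTa (by simp)
    refine h _ h2 _ h3 (hL.imp_mem h1
      (inLang_imp.2 ⟨hS _ h2, inLang_dual.2 (hT _ h3)⟩) fun v hv hv1 => ?_)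
    rw [hv.imp, hv.dual]
    intro hv2 hv3
    rw [hv.conj] at hv1 hv2 hv3
    obtain ⟨A, hA, hvA⟩ := hno v hv
    simp only [List.mem_filter, decide_eq_true_eq] at hv1 hv2 hv3
    rcases hl A hA with (hm | hm) | hm
    · exact hvA (hv1 A ⟨hA, hm⟩)
    · exact hvA (hv2 A ⟨hA, hm⟩)
    · exact hvA (hv3 A ⟨hA, hm⟩)
  exact ⟨v, ⟨hv, fun hA => hvS _ (.inl (.inl hA))⟩, fun A hA => hvS _ (.inl (.inr hA)),
    fun A hA => hvS _ (.inr hA)⟩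

theorem box_imp (hL : IsNormal D L) {v : Formula V → Prop} (hv : IsPoint L v) {d : Dir}
    (hd : d ∈ D) {A B : Formula V} (hA : A.InLang D) (hB : B.InLang D)
    (h : v (.box d (A.imp B))) (h' : v (.box d A)) : v (.box d B) := by
  have := hv.thm (hL.distr hd hA hB)
  -- Dualising turns the axiom into ¬□(A → B) ∨ ¬□A ∨ □B.
  rw [hv.or, hv.or, hv.dia, hv.dia, dual_dual, Formula.dual, dual_dual] at this
  rcases this with this | this | this
  · exact absurd h this
  · exact absurd h' this
  · exact this

theorem box_mono (hL : IsNormal D L) {v : Formula V → Prop} (hv : IsPoint L v) {d : Dir}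
    (hd : d ∈ D) {A B : Formula V} (h : A.imp B ∈ L) (h' : v (.box d A)) : v (.box d B) :=
  have hAB := inLang_imp.1 (hL.inLang h)
  hL.box_imp hv hd hAB.1 hAB.2 (hv.thm (hL.nec hd h)) h'

theorem box_and (hL : IsNormal D L) {v : Formula V → Prop} (hv : IsPoint L v) {d : Dir}
    (hd : d ∈ D) {A B : Formula V} (hA : A.InLang D) (hB : B.InLang D)
    (hvA : v (.box d A)) (hvB : v (.box d B)) : v (.box d (A.and B)) := by
  refine hL.box_imp hv hd hB ⟨hA, hB⟩ (hL.box_mono hv hd (hL.taut ?_ fun w hw => ?_) hvA) hvB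
  · exact inLang_imp.2 ⟨hA, inLang_imp.2 ⟨hB, hA, hB⟩⟩
  · rw [hw.imp, hw.imp, hw.and]
    exact fun h h' => ⟨h, h'⟩

theorem box_top (hL : IsNormal D L) {v : Formula V → Prop} (hv : IsPoint L v) {d : Dir}
    (hd : d ∈ D) : v (.box d .top) :=
  hv.thm (hL.nec hd (hL.taut trivial fun _ hw => hw.top))

/-- A theory all of whose members are possible at a point is true at a successor. -/
theorem exists_canRel (hL : IsNormal D L) {v : Formula V → Prop} (hv : IsPoint L v) {d : Dir}
    (hd : d ∈ D) {T : Set (Formula V)} (hT : ∀ A ∈ T, A.InLang D) (hTt : .top ∈ T)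
    (hTa : ∀ A ∈ T, ∀ B ∈ T, A.and B ∈ T) (h : ∀ A ∈ T, v (.dia d A)) :
    ∃ w, IsPoint L w ∧ CanRel D d v w ∧ ∀ A ∈ T, w A := by
  -- If some `A` with `□A` true at `v` refuted some `B ∈ T`, monotonicity would give `□¬B` at `v`,
  -- against `◇B`.
  obtain ⟨w, hw, hwS, hwT⟩ := hL.exists_point (S := {A | A.InLang D ∧ v (.box d A)}) (T := T)
    (fun A hA => hA.1) hT ⟨trivial, hL.box_top hv hd⟩ hTt
    (fun A hA B hB => ⟨⟨hA.1, hB.1⟩, hL.box_and hv hd hA.1 hB.1 hA.2 hB.2⟩) hTa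
    (fun A hA B hB hAB => hv.dia.1 (h B hB) (hL.box_mono hv hd hAB hA.2))
  exact ⟨w, hw, fun A hA hvA => hwS A ⟨hA, hvA⟩, hwT⟩

/-- The consequences of a formula are closed under conjunction. -/
theorem imp_and_mem (hL : IsNormal D L) {A B C : Formula V} (hB : A.imp B ∈ L)
    (hC : A.imp C ∈ L) : A.imp (B.and C) ∈ L := by
  have hB' := inLang_imp.1 (hL.inLang hB)
  have hC' := inLang_imp.1 (hL.inLang hC)
  refine hL.imp_mem (hL.and_mem hB hC) (inLang_imp.2 ⟨hB'.1, hB'.2, hC'.2⟩) fun v hv h => ?_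
  rw [hv.and, hv.imp, hv.imp] at h
  rw [hv.imp, hv.and]
  exact fun hA => ⟨h.1 hA, h.2 hA⟩

theorem imp_top_mem (hL : IsNormal D L) {A : Formula V} (hA : A.InLang D) :
    A.imp .top ∈ L :=
  hL.taut (inLang_imp.2 ⟨hA, trivial⟩) fun _ hv => hv.imp.2 fun _ => hv.top

theorem imp_self_mem (hL : IsNormal D L) {A : Formula V} (hA : A.InLang D) :
    A.imp A ∈ L :=
  hL.taut (inLang_imp.2 ⟨hA, hA⟩) fun _ hv => hv.imp.2 id

theorem exists_canRel_of_dia (hL : IsNormal D L) {v : Formula V → Prop} (hv : IsPoint L v)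
    {d : Dir} (hd : d ∈ D) {A : Formula V} (hA : A.InLang D) (h : v (.dia d A)) :
    ∃ w, IsPoint L w ∧ CanRel D d v w ∧ w A := by
  obtain ⟨w, hw, hvw, hT⟩ := hL.exists_canRel hv hd (T := {B | A.imp B ∈ L})
    (fun B hB => (inLang_imp.1 (hL.inLang hB)).2) (hL.imp_top_mem hA)
    (fun B hB C hC => hL.imp_and_mem hB hC) (fun B hB => by
      rw [hv.dia] at h ⊢
      have hB' := inLang_imp.1 (hL.inLang hB)
      refine fun hn => h (hL.box_mono hv hd (hL.imp_mem hB ?_ fun u hu h1 => ?_) hn)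
      · simpa using And.intro hB'.2 hB'.1
      · rw [hu.imp] at h1 ⊢
        rw [hu.dual, hu.dual]
        exact fun h2 h3 => h2 (h1 h3))
  exact ⟨w, hw, hvw, hT A (hL.imp_self_mem hA)⟩

end IsNormal

/-! ### The product of the canonical model with itself over a common language -/

/-- The formulae with modalities in `E` and variables in `X`. -/
def CommonLang (E : Set Dir) (X : Set V) : Set (Formula V) := {A | A.InLang E ∧ A.vars ⊆ X}

theorem dual_mem_commonLang {E : Set Dir} {X : Set V} {A : Formula V}
    (hA : A ∈ CommonLang E X) : A.dual ∈ CommonLang E X :=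
  ⟨inLang_dual.2 hA.1, by simpa using hA.2⟩

/-- Pairs of points of the canonical model that agree on a common language. -/
structure PointPair (L : Set (Formula V)) (E : Set Dir) (X : Set V) where
  fst : Formula V → Prop
  snd : Formula V → Prop
  isPoint_fst : IsPoint L fst
  isPoint_snd : IsPoint L snd
  agree : ∀ A ∈ CommonLang E X, fst A ↔ snd A

/-- The componentwise accessibility relations. -/
def pairRel (D : Set Dir) {L : Set (Formula V)} {E : Set Dir} {X : Set V} (d : Dir)
    (p q : PointPair L E X) : Prop :=
  CanRel D d p.fst q.fst ∧ CanRel D d p.snd q.snd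

/-! ### Bisimulation between points that agree on the common language. -/

section Zigzag

variable {D E : Set Dir} {L : Set (Formula V)} {X : Set V}

/-- The common language is closed under `dia d` for `d ∈ E`, so every common formula true at `v'` is
possible at `w`, and some successor of `w` satisfies them all. Closure under negation upgrades this
inclusion of theories to agreement. -/
theorem IsNormal.zigzag (hL : IsNormal D L) (hED : E ⊆ D) {d : Dir} (hd : d ∈ E)
    {v w v' : Formula V → Prop} (hv : IsPoint L v) (hw : IsPoint L w)
    (hvw : ∀ A ∈ CommonLang E X, v A ↔ w A) (hv' : IsPoint L v') (h : CanRel D d v v') :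
    ∃ w', IsPoint L w' ∧ CanRel D d w w' ∧ ∀ A ∈ CommonLang E X, v' A ↔ w' A := by
  obtain ⟨w', hw', hR, hT⟩ := hL.exists_canRel hw (hED hd)
    (T := {A | A ∈ CommonLang E X ∧ v' A}) (fun A hA => hA.1.1.mono hED)
    ⟨⟨trivial, by simp [vars]⟩, hv'.top⟩
    (fun A hA B hB => ⟨⟨⟨hA.1.1, hB.1.1⟩, Set.union_subset hA.1.2 hB.1.2⟩,
      (hv'.and A B).2 ⟨hA.2, hB.2⟩⟩)
    (fun A hA => (hvw (.dia d A) ⟨⟨hd, hA.1.1⟩, hA.1.2⟩).1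
      (h.dia hv.toIsValuation hv'.toIsValuation (hA.1.1.mono hED) hA.2))
  refine ⟨w', hw', hR, fun A hA => ⟨fun hv'A => hT A ⟨hA, hv'A⟩, fun hw'A => ?_⟩⟩
  by_contra hn
  exact (hw'.dual A).1 (hT _ ⟨dual_mem_commonLang hA, (hv'.dual A).2 hn⟩) hw'A

theorem IsNormal.exists_pairRel_fst (hL : IsNormal D L) (hED : E ⊆ D) {d : Dir} (hd : d ∈ E)
    (p : PointPair L E X) {v : Formula V → Prop} (hv : IsPoint L v) (h : CanRel D d p.fst v) :
    ∃ q : PointPair L E X, pairRel D d p q ∧ q.fst = v := by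
  obtain ⟨w, hw, hR, hvw⟩ := hL.zigzag hED hd p.isPoint_fst p.isPoint_snd p.agree hv h
  exact ⟨⟨v, w, hv, hw, hvw⟩, ⟨h, hR⟩, rfl⟩

theorem IsNormal.exists_pairRel_snd (hL : IsNormal D L) (hED : E ⊆ D) {d : Dir} (hd : d ∈ E)
    (p : PointPair L E X) {w : Formula V → Prop} (hw : IsPoint L w) (h : CanRel D d p.snd w) :
    ∃ q : PointPair L E X, pairRel D d p q ∧ q.snd = w := by
  obtain ⟨v, hv, hR, hwv⟩ := hL.zigzag hED hd p.isPoint_snd p.isPoint_fst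
    (fun A hA => (p.agree A hA).symm) hw h
  exact ⟨⟨v, w, hv, hw, fun A hA => (hwv A hA).symm⟩, ⟨hR, h⟩, rfl⟩

end Zigzag

/-! ### Kripke semantics -/

/-- Truth at a world of a Kripke model, with one accessibility relation for each direction. -/
def Sat {W : Type*} (R : Dir → W → W → Prop) (val : W → V → Prop) : W → Formula V → Prop
  | w, .pos p => val w p
  | w, .neg p => ¬ val w p
  | _, .top => True
  | _, .bot => False
  | w, .and A B => Sat R val w A ∧ Sat R val w B
  | w, .or A B => Sat R val w A ∨ Sat R val w B
  | w, .box d A => ∀ u, R d w u → Sat R val u A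
  | w, .dia d A => ∃ u, R d w u ∧ Sat R val u A

section Semantics

variable {W : Type*} {R : Dir → W → W → Prop} {val : W → V → Prop}

theorem sat_dual {w : W} {A : Formula V} : Sat R val w A.dual ↔ ¬ Sat R val w A := by
  induction A generalizing w <;> simp_all [Sat, Formula.dual, imp_iff_not_or]

theorem isValuation_sat (w : W) : IsValuation (V := V) (Sat R val w) :=
  ⟨trivial, fun _ _ => Iff.rfl, fun _ _ => Iff.rfl, fun _ => sat_dual⟩

theorem sat_imp {w : W} {A B : Formula V} :
    Sat R val w (A.imp B) ↔ (Sat R val w A → Sat R val w B) :=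
  (isValuation_sat w).imp

theorem sat_distr (d : Dir) (A B : Formula V) (w : W) :
    Sat R val w (.or (.dia d (.and A B.dual)) (.or (.dia d A.dual) (.box d B))) := by
  by_contra hn
  simp only [Sat, sat_dual] at hn
  push Not at hn
  obtain ⟨h1, h2, u, hu, hB⟩ := hn
  exact hB (h1 u hu (h2 u hu))

/-- The truth lemma for a bounded morphism into the canonical model. -/
theorem IsNormal.sat_iff {D E : Set Dir} {L : Set (Formula V)} (hL : IsNormal D L) (hED : E ⊆ D)
    {X : Set V} (f : W → Formula V → Prop) (hf : ∀ w, IsPoint L (f w))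
    (hval : ∀ w, ∀ p ∈ X, val w p ↔ f w (.pos p))
    (forth : ∀ d ∈ E, ∀ w u, R d w u → CanRel D d (f w) (f u))
    (back : ∀ d ∈ E, ∀ w v, IsPoint L v → CanRel D d (f w) v → ∃ u, R d w u ∧ f u = v)
    {A : Formula V} (hA : A.InLang E) (hX : A.vars ⊆ X) (w : W) : Sat R val w A ↔ f w A := by
  induction A generalizing w with
  | pos p => exact hval w p (hX rfl)
  | neg p =>
    rw [show Formula.neg p = (Formula.pos p).dual from rfl, (hf w).dual, sat_dual]
    exact not_congr (hval w p (hX rfl))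
  | top => exact iff_of_true trivial (hf w).top
  | bot => exact iff_of_false id (hf w).bot
  | and A B ihA ihB =>
    rw [(hf w).and, ← ihA hA.1 (Set.subset_union_left.trans hX),
      ← ihB hA.2 (Set.subset_union_right.trans hX)]
    rfl
  | or A B ihA ihB =>
    rw [(hf w).or, ← ihA hA.1 (Set.subset_union_left.trans hX),
      ← ihB hA.2 (Set.subset_union_right.trans hX)]
    rfl
  | box d A ih =>
    refine ⟨fun h => ?_, fun h u hu => ?_⟩
    · by_contra hn
      have hd : f w (.dia d A.dual) := by rwa [(hf w).dia, dual_dual]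
      obtain ⟨v, hv, hR, hvA⟩ := hL.exists_canRel_of_dia (hf w) (hED hA.1)
        (inLang_dual.2 (hA.2.mono hED)) hd
      obtain ⟨u, hu, rfl⟩ := back d hA.1 w v hv hR
      exact (hv.dual A).1 hvA ((ih hA.2 hX u).1 (h u hu))
    · exact (ih hA.2 hX u).2 (forth d hA.1 w u hu A (hA.2.mono hED) h)
  | dia d A ih =>
    refine ⟨fun ⟨u, hu, hA'⟩ => ?_, fun h => ?_⟩
    · exact (forth d hA.1 w u hu).dia (hf w).toIsValuation (hf u).toIsValuation
        (hA.2.mono hED) ((ih hA.2 hX u).1 hA')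
    · obtain ⟨v, hv, hR, hvA⟩ := hL.exists_canRel_of_dia (hf w) (hED hA.1)
        (hA.2.mono hED) h
      obtain ⟨u, hu, rfl⟩ := back d hA.1 w v hv hR
      exact ⟨u, hu, (ih hA.2 hX u).2 hvA⟩

end Semantics

/-- A normal logic that is valid on the products of its canonical frame has interpolation. -/
theorem IsNormal.exists_interpolant {D E : Set Dir} {L : Set (Formula V)} (hL : IsNormal D L)
    (hED : E ⊆ D)
    (sound : ∀ X : Set V, ∀ C ∈ L, ∀ val (p : PointPair L E X), Sat (pairRel D) val p C)
    {A B : Formula V} (hA : A.InLang E) (hB : B.InLang E) (hAB : A.imp B ∈ L) :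
    ∃ C : Formula V, C.InLang E ∧ C.vars ⊆ A.vars ∩ B.vars ∧ A.imp C ∈ L ∧ C.imp B ∈ L := by
  classical
  by_contra! hno
  have hAD := hA.mono hED
  have hBD := hB.mono hED
  -- A point for the negation of `B` together with all common consequences of `A`: an inconsistency
  -- would make one of these consequences an interpolant.
  obtain ⟨w, hw, hwS, hwT⟩ := hL.exists_point
    (S := {C | C ∈ CommonLang E (A.vars ∩ B.vars) ∧ A.imp C ∈ L})
    (T := {C | B.dual.imp C ∈ L}) (fun C hC => hC.1.1.mono hED)
    (fun C hC => (inLang_imp.1 (hL.inLang hC)).2)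
    ⟨⟨trivial, by simp [vars]⟩, hL.imp_top_mem hAD⟩ (hL.imp_top_mem (inLang_dual.2 hBD))
    (fun C hC C' hC' => ⟨⟨⟨hC.1.1, hC'.1.1⟩, Set.union_subset hC.1.2 hC'.1.2⟩,
      hL.imp_and_mem hC.2 hC'.2⟩)
    (fun C hC C' hC' => hL.imp_and_mem hC hC')
    (fun C hC C' hC' h => by
      refine hno C hC.1.1 hC.1.2 hC.2 (hL.imp_mem (hL.and_mem hC' h)
        (inLang_imp.2 ⟨hC.1.1.mono hED, hBD⟩) fun u hu hh => ?_)
      rw [hu.and, hu.imp, hu.imp, hu.dual, hu.dual] at hh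
      rw [hu.imp]
      tauto)
  -- A point for `A` with the common theory of `w`: if `A` refuted a member `C'` of that theory, the
  -- negation of `C'` would be a common consequence of `A` and so true at `w`.
  obtain ⟨v, hv, hvS, hvT⟩ := hL.exists_point
    (S := {C | A.imp C ∈ L})
    (T := {C | C ∈ CommonLang E (A.vars ∩ B.vars) ∧ w C})
    (fun C hC => (inLang_imp.1 (hL.inLang hC)).2) (fun C hC => hC.1.1.mono hED)
    (hL.imp_top_mem hAD) ⟨⟨trivial, by simp [vars]⟩, hw.top⟩
    (fun C hC C' hC' => hL.imp_and_mem hC hC')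
    (fun C hC C' hC' => ⟨⟨⟨hC.1.1, hC'.1.1⟩, Set.union_subset hC.1.2 hC'.1.2⟩,
      (hw.and C C').2 ⟨hC.2, hC'.2⟩⟩)
    (fun C hC C' hC' h => by
      have hC'D := inLang_dual.2 (hC'.1.1.mono hED)
      have : A.imp C'.dual ∈ L := by
        refine hL.imp_mem (hL.and_mem hC h) (inLang_imp.2 ⟨hAD, hC'D⟩) fun u hu hh => ?_
        rw [hu.and, hu.imp, hu.imp] at hh
        rw [hu.imp]
        tauto
      exact (hw.dual C').1 (hwS _ ⟨dual_mem_commonLang hC'.1, this⟩) hC'.2)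
  let p : PointPair L E (A.vars ∩ B.vars) := ⟨v, w, hv, hw, fun C hC => by
    refine ⟨fun hvC => ?_, fun hwC => hvT C ⟨hC, hwC⟩⟩
    by_contra hn
    exact (hv.dual C).1 (hvT _ ⟨dual_mem_commonLang hC, (hw.dual C).2 hn⟩) hvC⟩
  -- For a variable of `B` the choice of coordinate is immaterial: if it also occurs in `A`, it is
  -- shared and the coordinates agree on it.
  let val (q : PointPair L E (A.vars ∩ B.vars)) (x : V) : Prop :=
    if x ∈ A.vars then q.fst (.pos x) else q.snd (.pos x)
  have hpA : Sat (pairRel D) val p A := by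
    refine (hL.sat_iff hED (X := A.vars) PointPair.fst PointPair.isPoint_fst
      (fun q x hx => by simp [val, hx]) (fun d _ q r h => h.1)
      (fun d hd q u hu h => hL.exists_pairRel_fst hED hd q hu h) hA subset_rfl p).2 ?_
    exact hvS A (hL.imp_self_mem hAD)
  have hpB : Sat (pairRel D) val p B.dual := by
    refine (hL.sat_iff hED (X := B.vars) PointPair.snd PointPair.isPoint_snd
      (fun q x hx => ?_) (fun d _ q r h => h.2)
      (fun d hd q u hu h => hL.exists_pairRel_snd hED hd q hu h) (inLang_dual.2 hB)
      (by simp) p).2 ?_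
    · by_cases hxA : x ∈ A.vars
      · simpa [val, hxA] using q.agree (.pos x) ⟨trivial, by simp [vars, hxA, hx]⟩
      · simp [val, hxA]
    · exact hwT _ (hL.imp_self_mem (inLang_dual.2 hBD))
  exact sat_dual.1 hpB (sat_imp.1 (sound _ _ hAB val p) hpA)

/-! ### Tense logics with path axioms -/

theorem isNormal_Kt (P : Set PathAxiom) : IsNormal Set.univ (Kt V P) where
  inLang _ := inLang_univ _
  taut _ h := .taut h
  mp h h' := .mp h h'
  distr _ _ _ _ _ := .distr _ _ _
  nec _ _ h := .nec _ h

/-- Reachability along a word of directions. -/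
def PathRel {W : Type*} (R : Dir → W → W → Prop) : List Dir → W → W → Prop
  | [], w, u => w = u
  | d :: l, w, u => ∃ x, R d w x ∧ PathRel R l x u

theorem sat_diaList {W : Type*} {R : Dir → W → W → Prop} {val : W → V → Prop} {l : List Dir}
    {A : Formula V} {w : W} :
    Sat R val w (diaList l A) ↔ ∃ u, PathRel R l w u ∧ Sat R val u A := by
  induction l generalizing w with
  | nil => simp [diaList, PathRel]
  | cons d l ih =>
    change (∃ u, R d w u ∧ Sat R val u (diaList l A)) ↔ _
    simp only [ih, PathRel]
    grind

theorem KtProvable.sat {P : Set PathAxiom} {A : Formula V} (h : KtProvable P A) {W : Type*}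
    {R : Dir → W → W → Prop} (hconv : ∀ d w u, R d w u → R d.conv u w)
    (hpath : ∀ F ∈ P, ∀ w u, PathRel R F.path w u → R F.concl w u)
    (val : W → V → Prop) (w : W) : Sat R val w A := by
  induction h generalizing w with
  | taut h => exact h _ (isValuation_sat w)
  | conv d A => exact sat_imp.2 fun hA u hu => ⟨w, hconv d w u hu, hA⟩
  | distr d A B => exact sat_distr d A B w
  | path hF A =>
    refine sat_imp.2 fun h => ?_
    obtain ⟨u, hu, hA⟩ := sat_diaList.1 h
    exact ⟨u, hpath _ hF w u hu, hA⟩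
  | mp _ _ ih ih' => exact sat_imp.1 (ih' w) (ih w)
  | nec d _ ih => exact fun u _ => ih u

theorem canRel_conv {P : Set PathAxiom} {v w : Formula V → Prop} (hv : IsPoint (Kt V P) v)
    (hw : IsPoint (Kt V P) w) {d : Dir} (h : CanRel Set.univ d v w) :
    CanRel Set.univ d.conv w v := by
  intro A _ hA
  by_contra hn
  have h1 : v (.box d (.dia d.conv A.dual)) :=
    hv.imp.1 (hv.thm (KtProvable.conv d A.dual)) ((hv.dual A).2 hn)
  have h2 := h _ (inLang_univ _) h1
  rw [hw.dia, dual_dual] at h2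
  exact h2 hA

/-- Stated for an abstract `f` so that it serves both projections. -/
theorem diaList_of_pathRel {P : Set PathAxiom} {E : Set Dir} {X : Set V} {l : List Dir}
    (f : PointPair (Kt V P) E X → Formula V → Prop) (hf : ∀ p, IsPoint (Kt V P) (f p))
    (forth : ∀ d p q, pairRel Set.univ d p q → CanRel Set.univ d (f p) (f q))
    {p q : PointPair (Kt V P) E X} (h : PathRel (pairRel Set.univ) l p q) {A : Formula V}
    (hA : f q A) : f p (diaList l A) := by
  induction l generalizing p with
  | nil => rwa [show p = q from h]
  | cons d l ih =>
    obtain ⟨r, hr, h⟩ := h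
    exact (forth d p r hr).dia (hf p).toIsValuation (hf r).toIsValuation (inLang_univ _) (ih h)

theorem canRel_of_pathRel {P : Set PathAxiom} {E : Set Dir} {X : Set V} {F : PathAxiom}
    (hF : F ∈ P) (f : PointPair (Kt V P) E X → Formula V → Prop)
    (hf : ∀ p, IsPoint (Kt V P) (f p))
    (forth : ∀ d p q, pairRel Set.univ d p q → CanRel Set.univ d (f p) (f q))
    {p q : PointPair (Kt V P) E X} (h : PathRel (pairRel Set.univ) F.path p q) :
    CanRel Set.univ F.concl (f p) (f q) := by
  intro A _ hA
  by_contra hn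
  have h1 := diaList_of_pathRel f hf forth h (((hf q).dual A).2 hn)
  have h2 := (hf p).imp.1 ((hf p).thm (KtProvable.path hF A.dual)) h1
  rw [(hf p).dia, dual_dual] at h2
  exact h2 hA

/-- The language `E` only governs agreement and the back condition. The frame conditions concern
both directions but need the forth condition alone, so `E` may be the white modality only. -/
theorem Kt_exists_interpolant (P : Set PathAxiom) (E : Set Dir) {A B : Formula V}
    (hA : A.InLang E) (hB : B.InLang E) (hAB : A.imp B ∈ Kt V P) :
    ∃ C : Formula V, C.InLang E ∧ C.vars ⊆ A.vars ∩ B.vars ∧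
      A.imp C ∈ Kt V P ∧ C.imp B ∈ Kt V P := by
  refine (isNormal_Kt P).exists_interpolant (Set.subset_univ E) (fun X C hC val p => ?_)
    hA hB hAB
  refine KtProvable.sat hC (fun d p q h => ?_) (fun F hF p q h => ?_) val p
  · exact ⟨canRel_conv p.isPoint_fst q.isPoint_fst h.1,
      canRel_conv p.isPoint_snd q.isPoint_snd h.2⟩
  · exact ⟨canRel_of_pathRel hF PointPair.fst PointPair.isPoint_fst (fun _ _ _ h => h.1) h,
      canRel_of_pathRel hF PointPair.snd PointPair.isPoint_snd (fun _ _ _ h => h.2) h⟩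

/-! ### The modal cube -/

theorem CubeProvable.inLang {S : Set CubeAxiom} {A : Formula V} (h : CubeProvable S A) :
    A.InLang {Dir.future} := by
  induction h with
  | taut h _ => exact isModal_iff_inLang.1 h
  | distr hA hB =>
    rw [isModal_iff_inLang] at hA hB
    simp [InLang, hA, hB]
  | @cube a _ A hA =>
    rw [isModal_iff_inLang] at hA
    cases a <;> simp [CubeAxiom.inst, InLang, hA]
  | mp _ _ _ ih => exact (inLang_imp.1 ih).2
  | nec _ ih => exact ⟨rfl, ih⟩

theorem isNormal_cubeLogic (S : Set CubeAxiom) :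
    IsNormal {Dir.future} (cubeLogic V S) where
  inLang h := CubeProvable.inLang h
  taut h h' := .taut (isModal_iff_inLang.2 h) h'
  mp h h' := .mp h h'
  distr hd _ _ hA hB := by
    rw [Set.mem_singleton_iff.1 hd]
    exact .distr (isModal_iff_inLang.2 hA) (isModal_iff_inLang.2 hB)
  nec hd _ h := by
    rw [Set.mem_singleton_iff.1 hd]
    exact .nec h

/-- The frame condition that corresponds to an axiom of the modal cube. -/
def CubeAxiom.Holds {W : Type*} (R : W → W → Prop) : CubeAxiom → Prop
  | D => ∀ w, ∃ u, R w u
  | T => ∀ w, R w w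
  | B => ∀ w u, R w u → R u w
  | four => ∀ w u x, R w u → R u x → R w x
  | five => ∀ w u x, R w u → R w x → R u x

theorem CubeProvable.sat {S : Set CubeAxiom} {A : Formula V} (h : CubeProvable S A) {W : Type*}
    {R : Dir → W → W → Prop} (hR : ∀ a ∈ S, a.Holds (R .future))
    (val : W → V → Prop) (w : W) : Sat R val w A := by
  induction h generalizing w with
  | taut _ h => exact h _ (isValuation_sat w)
  | distr _ _ => exact sat_distr _ _ _ w
  | @cube a ha A _ =>
    have hRa := hR a ha
    cases a with
    | D => exact sat_imp.2 fun h => (hRa w).imp fun u hu => ⟨hu, h u hu⟩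
    | T => exact sat_imp.2 fun h => h w (hRa w)
    | B => exact sat_imp.2 fun h u hu => ⟨w, hRa w u hu, h⟩
    | four => exact sat_imp.2 fun h u hu x hx => h x (hRa w u x hu hx)
    | five => exact sat_imp.2 fun ⟨x, hx, h⟩ u hu => ⟨x, hRa w u x hu hx, h⟩
  | mp _ _ ih ih' => exact sat_imp.1 (ih' w) (ih w)
  | nec _ ih => exact fun u _ => ih u

/-! ### Frame conditions in the canonical model and on pairs of its points. -/

section CubeCanonical

variable {S : Set CubeAxiom} {v w u : Formula V → Prop}

theorem canRel_refl (hT : .T ∈ S) (hv : IsPoint (cubeLogic V S) v) :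
    CanRel {Dir.future} .future v v := fun _ hA h =>
  hv.imp.1 (hv.thm (CubeProvable.cube hT (isModal_iff_inLang.2 hA))) h

theorem canRel_symm (hB : .B ∈ S) (hv : IsPoint (cubeLogic V S) v)
    (hw : IsPoint (cubeLogic V S) w) (h : CanRel {Dir.future} .future v w) :
    CanRel {Dir.future} .future w v := by
  intro A hA hwA
  by_contra hn
  have hA' := inLang_dual.2 hA
  have h1 := hv.imp.1 (hv.thm (CubeProvable.cube hB (isModal_iff_inLang.2 hA')))
    ((hv.dual A).2 hn)
  have h2 := h (.dia .future A.dual) ⟨rfl, hA'⟩ h1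
  rw [hw.dia, dual_dual] at h2
  exact h2 hwA

theorem canRel_trans (h4 : .four ∈ S) (hv : IsPoint (cubeLogic V S) v)
    (h : CanRel {Dir.future} .future v w) (h' : CanRel {Dir.future} .future w u) :
    CanRel {Dir.future} .future v u := fun A hA hvA =>
  h' A hA (h _ ⟨rfl, hA⟩
    (hv.imp.1 (hv.thm (CubeProvable.cube h4 (isModal_iff_inLang.2 hA))) hvA))

theorem canRel_euclidean (h5 : .five ∈ S) (hv : IsPoint (cubeLogic V S) v)
    (hw : IsPoint (cubeLogic V S) w) (hu : IsPoint (cubeLogic V S) u)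
    (h : CanRel {Dir.future} .future v w) (h' : CanRel {Dir.future} .future v u) :
    CanRel {Dir.future} .future w u := by
  intro A hA hwA
  by_contra hn
  have hA' := inLang_dual.2 hA
  have h1 := hv.imp.1 (hv.thm (CubeProvable.cube h5 (isModal_iff_inLang.2 hA')))
    (h'.dia hv.toIsValuation hu.toIsValuation hA' ((hu.dual A).2 hn))
  have h2 := h (.dia .future A.dual) ⟨rfl, hA'⟩ h1
  rw [hw.dia, dual_dual] at h2
  exact h2 hwA

/-- Since `□⊤` is a theorem, `D` makes `◇⊤` true at every point. -/
theorem exists_canRel_future (hD : .D ∈ S) (hv : IsPoint (cubeLogic V S) v) :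
    ∃ w, IsPoint (cubeLogic V S) w ∧ CanRel {Dir.future} .future v w := by
  obtain ⟨w, hw, h, _⟩ := (isNormal_cubeLogic S).exists_canRel_of_dia hv rfl
    (A := .top) trivial (hv.imp.1 (hv.thm (CubeProvable.cube hD (A := .top) trivial))
      ((isNormal_cubeLogic S).box_top hv rfl))
  exact ⟨w, hw, h⟩

theorem holds_pairRel {a : CubeAxiom} (ha : a ∈ S) (X : Set V) :
    a.Holds (pairRel (L := cubeLogic V S) (E := {Dir.future}) (X := X) {Dir.future} .future) := by
  cases a with
  | D =>
    -- Seriality is existential, and independently chosen successors need not agree. One is chosen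
    -- for the first coordinate, and zigzag supplies a matching one for the second.
    intro p
    obtain ⟨v, hv, h⟩ := exists_canRel_future ha p.isPoint_fst
    obtain ⟨q, hq, _⟩ := (isNormal_cubeLogic S).exists_pairRel_fst subset_rfl rfl p hv h
    exact ⟨q, hq⟩
  | T => exact fun p => ⟨canRel_refl ha p.isPoint_fst, canRel_refl ha p.isPoint_snd⟩
  | B => exact fun p q h => ⟨canRel_symm ha p.isPoint_fst q.isPoint_fst h.1,
      canRel_symm ha p.isPoint_snd q.isPoint_snd h.2⟩
  | four => exact fun p q r h h' => ⟨canRel_trans ha p.isPoint_fst h.1 h'.1,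
      canRel_trans ha p.isPoint_snd h.2 h'.2⟩
  | five => exact fun p q r h h' =>
      ⟨canRel_euclidean ha p.isPoint_fst q.isPoint_fst r.isPoint_fst h.1 h'.1,
      canRel_euclidean ha p.isPoint_snd q.isPoint_snd r.isPoint_snd h.2 h'.2⟩

end CubeCanonical

theorem cubeLogic_exists_interpolant (S : Set CubeAxiom) {A B : Formula V}
    (hA : A.InLang {Dir.future}) (hB : B.InLang {Dir.future}) (hAB : A.imp B ∈ cubeLogic V S) :
    ∃ C : Formula V, C.InLang {Dir.future} ∧ C.vars ⊆ A.vars ∩ B.vars ∧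
      A.imp C ∈ cubeLogic V S ∧ C.imp B ∈ cubeLogic V S :=
  (isNormal_cubeLogic S).exists_interpolant subset_rfl
    (fun X _ hC val p => CubeProvable.sat hC (fun _ ha => holds_pairRel ha X) val p) hA hB hAB

end TenseLogic

/-- Every extension of `Kt` by path axioms has Craig interpolation; so does its restriction to
formulae without black modalities, and so does `K` and every other logic of the modal cube. -/
theorem mainTheorem2 (V : Type*) :
    (∀ P : Set TenseLogic.PathAxiom,
      TenseLogic.CraigInterpolation Set.univ (TenseLogic.Kt V P)) ∧
    (∀ P : Set TenseLogic.PathAxiom,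
      TenseLogic.CraigInterpolation (TenseLogic.modalFormulas V)
        (TenseLogic.Kt V P ∩ TenseLogic.modalFormulas V)) ∧
    (∀ S : Set TenseLogic.CubeAxiom,
      TenseLogic.CraigInterpolation (TenseLogic.modalFormulas V)
        (TenseLogic.cubeLogic V S)) := by
  refine ⟨fun P A _ B _ hAB => ?_, fun P A hA B hB hAB => ?_, fun S A hA B hB hAB => ?_⟩
  · obtain ⟨C, -, hC⟩ := TenseLogic.Kt_exists_interpolant P Set.univ
      (TenseLogic.Formula.inLang_univ A) (TenseLogic.Formula.inLang_univ B) hAB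
    exact ⟨C, trivial, hC⟩
  · have hA' := TenseLogic.Formula.isModal_iff_inLang.1 hA
    have hB' := TenseLogic.Formula.isModal_iff_inLang.1 hB
    obtain ⟨C, hC, hvars, hAC, hCB⟩ := TenseLogic.Kt_exists_interpolant P _ hA' hB' hAB.1
    exact ⟨C, TenseLogic.Formula.isModal_iff_inLang.2 hC, hvars,
      ⟨hAC, TenseLogic.Formula.isModal_iff_inLang.2
        (TenseLogic.Formula.inLang_imp.2 ⟨hA', hC⟩)⟩,
      ⟨hCB, TenseLogic.Formula.isModal_iff_inLang.2
        (TenseLogic.Formula.inLang_imp.2 ⟨hC, hB'⟩)⟩⟩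
  · obtain ⟨C, hC, h⟩ := TenseLogic.cubeLogic_exists_interpolant S
      (TenseLogic.Formula.isModal_iff_inLang.1 hA) (TenseLogic.Formula.isModal_iff_inLang.1 hB) hAB
    exact ⟨C, TenseLogic.Formula.isModal_iff_inLang.2 hC, h⟩
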